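/- Let $G=(V,E)$ be a finite simple $k$-regular graph whose adjacency matrix $A$ belongs to an association scheme, and let $\lambda_{\min}(A)$ be the smallest eigenvalue of $A$. Here an association scheme on $V$ is a finite set $\mathcal C$ of nonzero symmetric $V\times V$ matrices with entries in $\{0,1\}$ such that $\sum_{B\in\mathcal C}B$ is the all-ones matrix, every $B\in\mathcal C$ with a nonzero diagonal entry is diagonal, and the product of any two members of $\mathcal C$ is a linear combination of members of $\mathcal C$ with nonnegative integer coefficients. (In particular $A\neq 0$, so $k\ge 1$.) Put $$\eta^\circ(G)=\min\Big\{\mu : \mu\ge 0,\ N\succeq 0,\ N_{ii}=\mu\ \text{for all } i\in V,\ \tfrac14\,(N_{ii}+N_{jj}-2N_{ij})\ge 1\ \text{for all } ij\in E\Big\},$$ where $N$ ranges over the real symmetric $V\times V$ matrices, $$\mathrm{fcc}(G)=\min\Big\{\sum_{S\subseteq V}y_S : y_S\ge 0\ \text{for all } S\subseteq V,\ \sum_{S:\,e\in\delta(S)}y_S\ge 1\ \text{for all } e\in E\Big\},$$ where $\delta(S)$ is the set of edges with one end in $S$ and the other in $V\setminus S$, and $$\alpha_{\mathrm{GW}}=\min_{0<\theta\le\pi}\frac{2}{\pi}\,\frac{\theta}{1-\cos\theta}\approx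 0.878 .$$ Then the minima defining $\eta^\circ(G)$ and $\mathrm{fcc}(G)$ are attained, $$\eta^\circ(G)=\frac{2k}{k-\lambda_{\min}(A)},\qquad\text{and in particular}\qquad 1\le\frac{\mathrm{fcc}(G)}{\frac{2k}{k-\lambda_{\min}(A)}}\le\frac1{\alpha_{\mathrm{GW}}}.$$ -/

import Mathlib

/-- A coherent configuration on a finite vertex set `V`: a finite set of nonzero matrices with
entries in `{0, 1}` that sum to the all-ones matrix, is closed under transposition, in which a
matrix with a nonzero diagonal entry is diagonal, and in which the product of two members is a
combination of the members with nonnegative integer coefficients. -/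
structure IsCoherentConfiguration {V : Type*} [Fintype V]
    (C : Finset (Matrix V V ℝ)) : Prop where
  zero_or_one : ∀ A ∈ C, ∀ i j, A i j = 0 ∨ A i j = 1
  ne_zero : ∀ A ∈ C, A ≠ 0
  sum_eq : ∑ A ∈ C, A = Matrix.of fun _ _ => (1 : ℝ)
  transpose_mem : ∀ A ∈ C, A.transpose ∈ C
  isDiag : ∀ A ∈ C, (∃ i, A i i ≠ 0) → A.IsDiag
  mul_eq : ∀ A ∈ C, ∀ B ∈ C, ∃ p : Matrix V V ℝ → ℕ, A * B = ∑ D ∈ C, (p D : ℝ) • D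

/-- An association scheme: a coherent configuration all of whose matrices are symmetric. -/
structure IsAssociationScheme {V : Type*} [Fintype V]
    (C : Finset (Matrix V V ℝ)) : Prop extends IsCoherentConfiguration C where
  isSymm : ∀ A ∈ C, A.IsSymm

namespace SimpleGraph

/-- The adjoint of the Laplacian, at the pair `ij`: `L*(N)_{ij} = N_{ii} + N_{jj} - 2 N_{ij}`.
It is only used when `ij` is an edge. -/
def lapAdjoint {V : Type*} (N : Matrix V V ℝ) (i j : V) : ℝ :=
  N i i + N j j - 2 * N i j

/-- The objective values `μ` of the feasible solutions `(μ, N)` of the program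
`min {μ : μ ≥ 0, N ⪰ 0, diag N = μ 𝟙, (1/4) L*(N) ≥ 𝟙}`. -/
def etaDualValues {V : Type*} (G : SimpleGraph V) : Set ℝ :=
  {μ | 0 ≤ μ ∧ ∃ N : Matrix V V ℝ, N.PosSemidef ∧ N.diag = (fun _ => μ) ∧
    ∀ i j, G.Adj i j → 1 ≤ (1 / 4 : ℝ) * lapAdjoint N i j}

/-- `η°(G)`, the optimum value of the above semidefinite program. -/
noncomputable def etaDual {V : Type*} (G : SimpleGraph V) : ℝ :=
  sInf G.etaDualValues

/-- The cut `δ(S)`: the set of edges with one end in `S` and the other outside `S`. -/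
def cutEdges {V : Type*} (G : SimpleGraph V) (S : Finset V) : Set (Sym2 V) :=
  {e | e ∈ G.edgeSet ∧ ∃ u ∈ S, ∃ v, v ∉ S ∧ e = s(u, v)}

/-- The objective values `𝟙ᵀ y` of the feasible solutions of the program
`min {𝟙ᵀ y : y ≥ 0, ∑ S, y S • 𝟙_{δ(S)} ≥ 𝟙}`, where `S` ranges over all sets of vertices. -/
def fccValues {V : Type*} [Fintype V] (G : SimpleGraph V) : Set ℝ :=
  {t | ∃ y : Finset V → ℝ, (∀ S, 0 ≤ y S) ∧
    (∀ e ∈ G.edgeSet, 1 ≤ ∑ S, y S * (G.cutEdges S).indicator (fun _ => (1 : ℝ)) e) ∧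
    t = ∑ S, y S}

/-- The fractional cut-cover number `fcc(G)`. -/
noncomputable def fcc {V : Type*} [Fintype V] (G : SimpleGraph V) : ℝ :=
  sInf G.fccValues

end SimpleGraph

/-- The Goemans-Williamson constant `min_{0 < θ ≤ π} (2 / π) θ / (1 - cos θ) ≈ 0.878`. -/
noncomputable def alphaGW : ℝ :=
  sInf ((fun θ : ℝ => 2 / Real.pi * (θ / (1 - Real.cos θ))) '' Set.Ioc 0 Real.pi)

/-!
Both programs are compared through the semidefinite program defining `η°(G)`, whose optimum is
first computed in closed form.

*The semidefinite program.* Let `A` be the adjacency matrix and `lam` its least eigenvalue, so that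
`A - lam • 1` is positive semidefinite. If `(μ, N)` is feasible, then summing the edge constraints
and using `0 ≤ ⟨A - lam • 1, N⟩` gives `μ ≥ 2 k / (k - lam)`
(`SimpleGraph.IsRegularOfDegree.le_of_mem_etaDualValues`); this uses only regularity. The scheme
supplies a feasible matrix of that value
(`SimpleGraph.mem_etaDualValues_of_isAssociationScheme`): with `p` the cofactor of `X - lam` in the
minimal polynomial of `A`, the matrix `M = p(A) ^ 2` is nonzero, positive semidefinite and satisfies
`A * M = lam • M`. Polynomials in `A` lie in the span of the scheme, hence are constant on the
diagonal and on the edges (`IsCoherentConfiguration.apply_eq_apply_of_mem_span`). Reading off a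
diagonal entry of `A * M = lam • M` determines the ratio of these two constants, and a multiple of
`M` is optimal.

*The cut covers.* A fractional cut cover `y` gives the feasible matrix `∑ S, y S • x_S x_Sᵀ`, where
`x_S` is the signed indicator of `S`, so `η°(G) ≤ fcc(G)`
(`SimpleGraph.fccValues_subset_etaDualValues`). Conversely, a feasible `N` is rounded as by Goemans
and Williamson (`SimpleGraph.div_alphaGW_mem_fccValues`): after scaling, `N` is the Gram matrix of
unit vectors, a random hyperplane cuts the edge `ij` with probability `θ / π`, where `θ` is the
angle between the vectors of `i` and `j`, and `θ / π ≥ alphaGW * (1 - cos θ) / 2`.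

The hyperplane probability (`ballProb_real_separatingSet`) is obtained without integration. For a
normal vector uniform in the unit ball, the probability of separating two points of a circle is
invariant under reflections and additive in the angle, and it is `1` at angle `π`; a nonnegative
additive function on `[0, π]` is linear.
-/

/-! ### Association schemes -/

section Scheme

variable {V : Type*} [Fintype V] {C : Finset (Matrix V V ℝ)}

namespace IsCoherentConfiguration

theorem exists_mem_apply_eq_one (hC : IsCoherentConfiguration C) (i j : V) :
    ∃ B ∈ C, B i j = 1 := by
  by_contra! h
  have h1 : ∑ B ∈ C, B i j = 1 := by
    rw [← Matrix.sum_apply, hC.sum_eq, Matrix.of_apply]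
  rw [Finset.sum_eq_zero fun B hB => (hC.zero_or_one B hB i j).resolve_right (h B hB)] at h1
  exact zero_ne_one h1

/-- The members of a coherent configuration have disjoint supports. -/
theorem eq_of_apply_eq_one (hC : IsCoherentConfiguration C) {B D : Matrix V V ℝ} (hB : B ∈ C)
    (hD : D ∈ C) {i j : V} (hBij : B i j = 1) (hDij : D i j = 1) : B = D := by
  classical
  by_contra hne
  have h1 : ∑ M ∈ C, M i j = 1 := by
    rw [← Matrix.sum_apply, hC.sum_eq, Matrix.of_apply]
  have h2 : ∑ M ∈ ({B, D} : Finset _), M i j ≤ ∑ M ∈ C, M i j := by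
    refine Finset.sum_le_sum_of_subset_of_nonneg ?_ fun M hM _ => ?_
    · simp [Finset.insert_subset_iff, hB, hD]
    · rcases hC.zero_or_one M hM i j with h | h <;> simp [h]
  rw [Finset.sum_pair hne, hBij, hDij, h1] at h2
  norm_num at h2

/-- A matrix in the linear span of a coherent configuration is constant on the support of each
member. -/
theorem apply_eq_apply_of_mem_span (hC : IsCoherentConfiguration C) {M : Matrix V V ℝ}
    (hM : M ∈ Submodule.span ℝ (C : Set (Matrix V V ℝ))) {B : Matrix V V ℝ} (hB : B ∈ C)
    {i j i' j' : V} (h : B i j = 1) (h' : B i' j' = 1) : M i j = M i' j' := by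
  induction hM using Submodule.span_induction with
  | mem D hD =>
    by_cases hBD : B = D
    · rw [← hBD, h, h']
    · rw [(hC.zero_or_one D hD i j).resolve_right fun h1 => hBD (hC.eq_of_apply_eq_one hB hD h h1),
        (hC.zero_or_one D hD i' j').resolve_right
          fun h1 => hBD (hC.eq_of_apply_eq_one hB hD h' h1)]
  | zero => rfl
  | add x y _ _ hx hy => simp [hx, hy]
  | smul a x _ hx => simp [hx]

theorem mul_mem_span (hC : IsCoherentConfiguration C) {M B : Matrix V V ℝ}
    (hM : M ∈ Submodule.span ℝ (C : Set (Matrix V V ℝ))) (hB : B ∈ C) :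
    M * B ∈ Submodule.span ℝ (C : Set (Matrix V V ℝ)) := by
  induction hM using Submodule.span_induction with
  | mem D hD =>
    obtain ⟨p, hp⟩ := hC.mul_eq D hD B hB
    rw [hp]
    exact Submodule.sum_mem _ fun M hM => Submodule.smul_mem _ _ (Submodule.subset_span hM)
  | zero => simp
  | add x y _ _ hx hy => rw [add_mul]; exact Submodule.add_mem _ hx hy
  | smul a x _ hx => rw [Matrix.smul_mul]; exact Submodule.smul_mem _ _ hx

end IsCoherentConfiguration

/-- The identity matrix belongs to an association scheme: multiplying a diagonal member `D` by the
symmetric member whose support contains `(i, j)` and `(j, i)` shows `D i i = D j j`. -/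
theorem IsAssociationScheme.one_mem [DecidableEq V] [Nonempty V] (hC : IsAssociationScheme C) :
    (1 : Matrix V V ℝ) ∈ C := by
  have hcc := hC.toIsCoherentConfiguration
  obtain ⟨i⟩ := ‹Nonempty V›
  obtain ⟨D, hD, hDi⟩ := hcc.exists_mem_apply_eq_one i i
  have hdiag : D.IsDiag := hcc.isDiag D hD ⟨i, by simp [hDi]⟩
  have hmul : ∀ (B : Matrix V V ℝ) (a b : V), (D * B) a b = D a a * B a b := by
    intro B a b
    rw [Matrix.mul_apply, Finset.sum_eq_single a]
    · intro c _ hca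
      rw [hdiag hca.symm, zero_mul]
    · simp
  have hall : ∀ j, D j j = 1 := by
    intro j
    obtain ⟨B, hB, hBij⟩ := hcc.exists_mem_apply_eq_one i j
    have hBji : B j i = 1 := by rw [← hBij]; exact (hC.isSymm B hB).apply i j
    have := hcc.apply_eq_apply_of_mem_span (hcc.mul_mem_span (Submodule.subset_span hD) hB) hB
      hBij hBji
    rw [hmul, hmul, hBij, hBji, hDi] at this
    simpa using this.symm
  convert hD
  ext a b
  by_cases hab : a = b
  · rw [hab, hall, Matrix.one_apply_eq]
  · rw [Matrix.one_apply_ne hab, hdiag hab]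

theorem IsAssociationScheme.isSymm_of_mem_span (hC : IsAssociationScheme C) {M : Matrix V V ℝ}
    (hM : M ∈ Submodule.span ℝ (C : Set (Matrix V V ℝ))) : M.IsSymm := by
  induction hM using Submodule.span_induction with
  | mem D hD => exact hC.isSymm D hD
  | zero => exact Matrix.isSymm_zero
  | add x y _ _ hx hy => exact hx.add hy
  | smul a x _ hx => exact hx.smul a

theorem IsAssociationScheme.aeval_mem_span [DecidableEq V] [Nonempty V]
    (hC : IsAssociationScheme C) {B : Matrix V V ℝ} (hB : B ∈ C) (p : Polynomial ℝ) :
    Polynomial.aeval B p ∈ Submodule.span ℝ (C : Set (Matrix V V ℝ)) := by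
  have hpow : ∀ n : ℕ, B ^ n ∈ Submodule.span ℝ (C : Set (Matrix V V ℝ)) := by
    intro n
    induction n with
    | zero => rw [pow_zero]; exact Submodule.subset_span hC.one_mem
    | succ n ih => rw [pow_succ]; exact hC.toIsCoherentConfiguration.mul_mem_span ih hB
  rw [Polynomial.aeval_eq_sum_range]
  exact Submodule.sum_mem _ fun n _ => Submodule.smul_mem _ _ (hpow n)

end Scheme

/-! ### Positive semidefinite matrices and the least eigenvalue -/

section PosSemidef

open Matrix

variable {V : Type*} [Fintype V]

theorem Matrix.PosSemidef.sum_sum_mul_nonneg {M N : Matrix V V ℝ} (hM : M.PosSemidef)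
    (hN : N.PosSemidef) : 0 ≤ ∑ i, ∑ j, M i j * N i j := by
  obtain ⟨m, v, rfl⟩ := Matrix.posSemidef_iff_eq_sum_vecMulVec.mp hN
  have key : ∑ i, ∑ j, M i j * (∑ l, vecMulVec (v l) (star (v l))) i j =
      ∑ l, star (v l) ⬝ᵥ (M *ᵥ v l) := by
    simp only [Matrix.sum_apply, vecMulVec_apply, dotProduct, mulVec, Finset.mul_sum, star_trivial]
    rw [Finset.sum_comm_cycle]
    exact Finset.sum_congr rfl fun l _ => Finset.sum_congr rfl fun i _ =>
      Finset.sum_congr rfl fun j _ => by ring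
  rw [key]
  exact Finset.sum_nonneg fun l _ => hM.dotProduct_mulVec_nonneg (v l)

theorem Matrix.IsHermitian.posSemidef_sub_smul_one [DecidableEq V] {A : Matrix V V ℝ}
    (hA : A.IsHermitian) {lam : ℝ}
    (hlam : ∀ x, Module.End.HasEigenvalue (Matrix.toLin' A) x → lam ≤ x) :
    (A - lam • (1 : Matrix V V ℝ)).PosSemidef := by
  refine Matrix.posSemidef_iff_isHermitian_and_spectrum_nonneg.mpr ⟨?_, fun x hx => ?_⟩
  · exact hA.sub (by simp [Matrix.IsHermitian])
  · have hx' : x + lam ∈ spectrum ℝ A := by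
      rw [← Algebra.algebraMap_eq_smul_one] at hx
      rw [add_comm]
      have := spectrum.add_mem_add_iff (a := A - algebraMap ℝ _ lam) (r := x) (s := lam)
      rw [add_sub_cancel, add_comm] at this
      exact this.mpr hx
    rw [← Matrix.spectrum_toLin', ← Module.End.hasEigenvalue_iff_mem_spectrum] at hx'
    have := hlam _ hx'
    simp only [Set.mem_ofPred_eq]
    linarith

/-- For an eigenvalue `lam` of `A` there is a polynomial `p` with `p(A) ≠ 0` and
`A * p(A) = lam • p(A)`: the cofactor of `X - lam` in the minimal polynomial. -/
theorem Matrix.exists_aeval_ne_zero_of_hasEigenvalue [DecidableEq V] (A : Matrix V V ℝ) {lam : ℝ}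
    (hlam : Module.End.HasEigenvalue (Matrix.toLin' A) lam) :
    ∃ p : Polynomial ℝ, Polynomial.aeval A p ≠ 0 ∧
      A * Polynomial.aeval A p = lam • Polynomial.aeval A p := by
  have hroot := Module.End.hasEigenvalue_iff_isRoot.mp hlam
  rw [Matrix.minpoly_toLin'] at hroot
  obtain ⟨p, hp⟩ := Polynomial.dvd_iff_isRoot.mpr hroot
  have hint : IsIntegral ℝ A := Matrix.isIntegral A
  have hmin := minpoly.ne_zero hint
  refine ⟨p, fun h0 => ?_, ?_⟩
  · have hp0 : p ≠ 0 := by rintro rfl; simp [hp] at hmin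
    have hdeg := Polynomial.natDegree_le_of_dvd (minpoly.dvd ℝ A h0) hp0
    rw [hp, Polynomial.natDegree_mul (Polynomial.X_sub_C_ne_zero lam) hp0,
      Polynomial.natDegree_X_sub_C] at hdeg
    omega
  · have h := minpoly.aeval ℝ A
    rw [hp, map_mul, map_sub, Polynomial.aeval_X, Polynomial.aeval_C, sub_mul, sub_eq_zero,
      Algebra.algebraMap_eq_smul_one, smul_mul_assoc, one_mul] at h
    exact h

end PosSemidef

/-! ### The value of the semidefinite program -/

namespace SimpleGraph

open Matrix

variable {V : Type*} [Fintype V] [DecidableEq V] {G : SimpleGraph V} [DecidableRel G.Adj] {k : ℕ}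
  {lam : ℝ}

/-- The least eigenvalue of an adjacency matrix is nonpositive, as its diagonal vanishes. -/
theorem nonpos_of_posSemidef_adjMatrix_sub {V : Type*} [DecidableEq V] [Nonempty V]
    {G : SimpleGraph V} [DecidableRel G.Adj]
    (hlam : (G.adjMatrix ℝ - lam • (1 : Matrix V V ℝ)).PosSemidef) : lam ≤ 0 := by
  obtain ⟨i⟩ := ‹Nonempty V›
  have := hlam.diag_nonneg (i := i)
  simpa using this

/-- Every feasible value of the semidefinite program of a regular graph is at least
`2 k / (k - lam)`: sum the edge constraints over all ordered adjacent pairs and use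
`0 ≤ ⟨A - lam • 1, N⟩`. -/
theorem IsRegularOfDegree.le_of_mem_etaDualValues [Nonempty V] (hk : G.IsRegularOfDegree k)
    (hk0 : 0 < (k : ℝ) - lam) (hlam : (G.adjMatrix ℝ - lam • (1 : Matrix V V ℝ)).PosSemidef)
    {μ : ℝ} (hμ : μ ∈ G.etaDualValues) : 2 * (k : ℝ) / ((k : ℝ) - lam) ≤ μ := by
  obtain ⟨-, N, hN, hdiag, hedge⟩ := hμ
  have hNd : ∀ i, N i i = μ := fun i => congrFun hdiag i
  have hcard : (0 : ℝ) < Fintype.card V := by exact_mod_cast Fintype.card_pos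
  have hdeg : ∀ i, ∑ j, G.adjMatrix ℝ i j = k := by
    intro i
    have := G.adjMatrix_mulVec_const_apply_of_regular (a := (1 : ℝ)) hk (v := i)
    simpa [Matrix.mulVec, dotProduct] using this
  have h1 := hlam.sum_sum_mul_nonneg hN
  have h2 : ∑ i, ∑ j, (G.adjMatrix ℝ - lam • (1 : Matrix V V ℝ)) i j * N i j =
      ∑ i, ∑ j, G.adjMatrix ℝ i j * N i j - Fintype.card V * (lam * μ) := by
    simp only [Matrix.sub_apply, Matrix.smul_apply, Matrix.one_apply, sub_mul,
      Finset.sum_sub_distrib]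
    simp [hNd]
  have h3 : ∑ i, ∑ j, G.adjMatrix ℝ i j * N i j ≤ ∑ i, ∑ j, G.adjMatrix ℝ i j * (μ - 2) := by
    refine Finset.sum_le_sum fun i _ => Finset.sum_le_sum fun j _ => ?_
    rw [adjMatrix_apply]
    split_ifs with hij
    · have := hedge i j hij
      rw [lapAdjoint, hNd, hNd] at this
      linarith
    · simp
  simp only [← Finset.sum_mul, hdeg] at h3
  rw [Finset.sum_const, Finset.card_univ, nsmul_eq_mul] at h3
  rw [h2] at h1
  rw [div_le_iff₀ hk0]
  have h4 : 0 ≤ (Fintype.card V : ℝ) * (k * (μ - 2) - lam * μ) := by linarith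
  have := nonneg_of_mul_nonneg_right h4 hcard
  linarith

/-- In an association scheme containing the adjacency matrix `A`, the square of a polynomial in `A`
whose columns are eigenvectors for `lam` has constant diagonal and is constant on edges; rescaling
it gives a feasible solution of value `2 k / (k - lam)`. -/
theorem mem_etaDualValues_of_isAssociationScheme [Nonempty V] (hk : G.IsRegularOfDegree k)
    (hk0 : 0 < k) (hlam0 : lam ≤ 0) {C : Finset (Matrix V V ℝ)} (hC : IsAssociationScheme C)
    (hA : G.adjMatrix ℝ ∈ C)
    (hlam : Module.End.HasEigenvalue (Matrix.toLin' (G.adjMatrix ℝ)) lam) :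
    2 * (k : ℝ) / ((k : ℝ) - lam) ∈ G.etaDualValues := by
  have hk0' : (0 : ℝ) < k := by exact_mod_cast hk0
  have hkl : 0 < (k : ℝ) - lam := by linarith
  set A := G.adjMatrix ℝ with hAdef
  obtain ⟨p, hp0, hp⟩ := A.exists_aeval_ne_zero_of_hasEigenvalue hlam
  set P := Polynomial.aeval A p with hP
  set M := P * P with hM
  have hspan : ∀ q : Polynomial ℝ, Polynomial.aeval A q ∈ Submodule.span ℝ (C : Set _) :=
    hC.aeval_mem_span hA
  have hcc := hC.toIsCoherentConfiguration
  have hMspan : M ∈ Submodule.span ℝ (C : Set (Matrix V V ℝ)) := by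
    rw [hM, hP, ← map_mul]; exact hspan _
  have hPsymm : Pᴴ = P := by
    rw [Matrix.conjTranspose_eq_transpose_of_trivial]
    exact hC.isSymm_of_mem_span (hspan p)
  have hMpsd : M.PosSemidef := by
    have := Matrix.posSemidef_conjTranspose_mul_self P
    rwa [hPsymm] at this
  have hAM : A * M = lam • M := by rw [hM, ← mul_assoc, hp, smul_mul_assoc]
  -- the constant diagonal entry `d` and the constant entry on edges `e`
  obtain ⟨i₀⟩ := ‹Nonempty V›
  obtain ⟨j₀, hj₀⟩ : ∃ j, G.Adj i₀ j := by
    rw [← G.degree_pos_iff_exists_adj, hk i₀]; exact hk0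
  have hd : ∀ i, M i i = M i₀ i₀ := fun i =>
    hcc.apply_eq_apply_of_mem_span hMspan (hC.one_mem (V := V)) (Matrix.one_apply_eq i)
      (Matrix.one_apply_eq i₀)
  have he : ∀ i j, G.Adj i j → M i j = M i₀ j₀ := fun i j hij =>
    hcc.apply_eq_apply_of_mem_span hMspan hA (by simp [hAdef, hij]) (by simp [hAdef, hj₀])
  have hd0 : 0 < M i₀ i₀ := by
    refine lt_of_le_of_ne hMpsd.diag_nonneg fun h0 => hp0 ?_
    have htr : M.trace = 0 := by simp [Matrix.trace, hd, ← h0]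
    rw [← Matrix.trace_conjTranspose_mul_self_eq_zero_iff, hPsymm]
    exact htr
  have hke : (k : ℝ) * M i₀ j₀ = lam * M i₀ i₀ := by
    have := congrFun (congrFun hAM i₀) i₀
    rw [hAdef, adjMatrix_mul_apply, Matrix.smul_apply, smul_eq_mul] at this
    rw [← this, Finset.sum_congr rfl fun j hj =>
      he j i₀ (G.adj_symm ((G.mem_neighborFinset i₀ j).mp hj)), Finset.sum_const,
      G.card_neighborFinset_eq_degree, hk i₀, nsmul_eq_mul]
  have hμ : 0 ≤ 2 * (k : ℝ) / ((k : ℝ) - lam) := by positivity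
  refine ⟨hμ, (2 * (k : ℝ) / ((k : ℝ) - lam) / M i₀ i₀) • M, ?_, ?_, ?_⟩
  · exact hMpsd.smul (by positivity)
  · ext i
    rw [Matrix.diag_apply, Matrix.smul_apply, hd i, smul_eq_mul]
    exact div_mul_cancel₀ _ hd0.ne'
  · intro i j hij
    have hej : M i₀ j₀ = lam * M i₀ i₀ / k := by
      rw [eq_div_iff hk0'.ne']; linarith
    simp only [lapAdjoint, Matrix.smul_apply, smul_eq_mul, hd, he i j hij, hej]
    apply le_of_eq
    field_simp
    ring

end SimpleGraph

/-! ### Random hyperplanes -/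

section RandomHyperplane

open MeasureTheory Real InnerProductGeometry
open scoped RealInnerProductSpace

/-- A nonnegative additive function on `[0, L]` is linear: the deviation `g` from the linear
function with the same value at `L` satisfies `g t' = 2 * g t` for `t' = 2 * t` or
`t' = 2 * t - L`, so a negative value would make `g` unbounded below. -/
theorem eq_div_mul_of_add_of_nonneg {f : ℝ → ℝ} {L : ℝ} (hL : 0 < L)
    (hf : ∀ t, 0 ≤ t → t ≤ L → 0 ≤ f t)
    (hadd : ∀ s t, 0 ≤ s → 0 ≤ t → s + t ≤ L → f (s + t) = f s + f t) {t : ℝ} (ht0 : 0 ≤ t)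
    (htL : t ≤ L) : f t = t / L * f L := by
  obtain ⟨g, hg⟩ : ∃ g : ℝ → ℝ, ∀ t, g t = f t - t / L * f L := ⟨_, fun _ => rfl⟩
  have hgadd : ∀ s t, 0 ≤ s → 0 ≤ t → s + t ≤ L → g (s + t) = g s + g t := by
    intro s t hs ht hst
    rw [hg, hg, hg, hadd s t hs ht hst]
    ring
  have hgL : g L = 0 := by rw [hg, div_self hL.ne', one_mul, sub_self]
  have hcompl : ∀ t, 0 ≤ t → t ≤ L → g (L - t) = -g t := by
    intro t h0 h1
    have := hgadd t (L - t) h0 (by linarith) (by linarith)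
    rw [add_sub_cancel, hgL] at this
    linarith
  have hdouble : ∀ t, 0 ≤ t → t + t ≤ L → g (t + t) = 2 * g t := by
    intro t h0 h1
    rw [hgadd t t h0 h0 h1]
    ring
  have hbound : ∀ n : ℕ, ∀ t, 0 ≤ t → t ≤ L → -f L ≤ 2 ^ n * g t := by
    intro n
    induction n with
    | zero =>
      intro t h0 h1
      have h2 : t / L * f L ≤ 1 * f L :=
        mul_le_mul_of_nonneg_right ((div_le_one hL).mpr h1) (hf L hL.le le_rfl)
      have := hf t h0 h1
      rw [pow_zero, one_mul, hg]
      linarith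
    | succ n ih =>
      intro t h0 h1
      rw [pow_succ, mul_assoc]
      rcases le_total (t + t) L with h | h
      · rw [← hdouble t h0 h]
        exact ih _ (by linarith) h
      · have h2 := hdouble (L - t) (by linarith) (by linarith)
        rw [hcompl t h0 h1] at h2
        have h3 := hcompl (L - t + (L - t)) (by linarith) (by linarith)
        rw [h2] at h3
        have h4 := ih (L - (L - t + (L - t))) (by linarith) (by linarith)
        rw [h3] at h4
        linarith
  have hnonneg : ∀ t, 0 ≤ t → t ≤ L → 0 ≤ g t := by
    intro t h0 h1
    by_contra! hneg
    obtain ⟨n, hn⟩ := pow_unbounded_of_one_lt (f L / -g t) (one_lt_two (α := ℝ))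
    rw [div_lt_iff₀ (by linarith)] at hn
    linarith [hbound n t h0 h1]
  have h1 := hnonneg t ht0 htL
  have h2 := hnonneg (L - t) (by linarith) (by linarith)
  rw [hcompl t ht0 htL] at h2
  have h3 : g t = 0 := le_antisymm (by linarith) h1
  rw [hg] at h3
  linarith

variable {E : Type*} [NormedAddCommGroup E] [InnerProductSpace ℝ E]

/-- The set of `x` whose orthogonal hyperplane separates `a` from `b`; points on the hyperplane
count as lying on the positive side. -/
def separatingSet (a b : E) : Set E := {x | ¬(0 ≤ ⟪a, x⟫ ↔ 0 ≤ ⟪b, x⟫)}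

theorem separatingSet_comm (a b : E) : separatingSet a b = separatingSet b a := by
  ext x
  simp only [separatingSet, Set.mem_ofPred_eq]
  tauto

theorem preimage_separatingSet (L : E ≃ₗᵢ[ℝ] E) (a b : E) :
    L ⁻¹' separatingSet (L a) (L b) = separatingSet a b := by
  ext x
  simp [separatingSet]

/-- The point at angle `t` on the circle through the orthonormal vectors `u` and `w`. -/
noncomputable def circlePoint (u w : E) (t : ℝ) : E := cos t • u + sin t • w

theorem inner_circlePoint {u w : E} (hu : ‖u‖ = 1) (hw : ‖w‖ = 1)
    (huw : ⟪u, w⟫ = 0) (s t : ℝ) :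
    ⟪circlePoint u w s, circlePoint u w t⟫ = cos (s - t) := by
  have hwu : ⟪w, u⟫ = 0 := by rw [real_inner_comm, huw]
  simp only [circlePoint, inner_add_left, inner_add_right, real_inner_smul_left,
    real_inner_smul_right, real_inner_self_eq_norm_sq, hu, hw, huw, hwu, cos_sub]
  ring

theorem norm_circlePoint {u w : E} (hu : ‖u‖ = 1) (hw : ‖w‖ = 1)
    (huw : ⟪u, w⟫ = 0) (t : ℝ) :
    ‖circlePoint u w t‖ = 1 := by
  have h := inner_circlePoint hu hw huw t t
  rw [sub_self, cos_zero, real_inner_self_eq_norm_sq] at h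
  exact (pow_eq_one_iff_of_nonneg (norm_nonneg _) two_ne_zero).mp h

theorem reflection_circlePoint {u w : E} (hu : ‖u‖ = 1) (hw : ‖w‖ = 1)
    (huw : ⟪u, w⟫ = 0) (r t : ℝ) :
    (Submodule.span ℝ {circlePoint u w r}).reflection (circlePoint u w t) =
      circlePoint u w (2 * r - t) := by
  have h1 : 2 * r - t = r - (t - r) := by ring
  have h2 : t = r + (t - r) := by ring
  rw [Submodule.reflection_singleton_apply, real_inner_comm,
    inner_circlePoint hu hw huw, norm_circlePoint hu hw huw, h1]
  generalize t - r = d at *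
  subst h2
  simp only [circlePoint, RCLike.ofReal_real_eq_id, id, cos_sub, sin_sub, cos_add, sin_add]
  module

variable [MeasurableSpace E] [BorelSpace E]

theorem measurableSet_separatingSet (a b : E) : MeasurableSet (separatingSet a b) := by
  have h : ∀ c : E, MeasurableSet {x : E | 0 ≤ ⟪c, x⟫} := fun c =>
    (isClosed_le continuous_const (by fun_prop)).measurableSet
  exact (MeasurableSet.iff (h a) (h b)).compl

variable [FiniteDimensional ℝ E]

variable (E) in
/-- The uniform probability distribution on the unit ball. The only properties that matter are
invariance under linear isometries and absolute continuity. -/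
noncomputable def ballProb : Measure E := ProbabilityTheory.cond volume (Metric.ball 0 1)

instance : IsProbabilityMeasure (ballProb E) :=
  ProbabilityTheory.cond_isProbabilityMeasure_of_finite
    (Metric.measure_ball_pos volume _ one_pos).ne' measure_ball_lt_top.ne

theorem measurePreserving_ballProb (L : E ≃ₗᵢ[ℝ] E) :
    MeasurePreserving L (ballProb E) (ballProb E) := by
  have h := (L.measurePreserving.restrict_preimage
    (Metric.isOpen_ball (x := (0 : E)) (ε := 1)).measurableSet).smul_measure
      (volume (Metric.ball (0 : E) 1))⁻¹
  rw [L.preimage_ball, map_zero] at h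
  exact h

theorem ballProb_real_separatingSet_map (L : E ≃ₗᵢ[ℝ] E) (a b : E) :
    (ballProb E).real (separatingSet (L a) (L b)) = (ballProb E).real (separatingSet a b) := by
  rw [← preimage_separatingSet L a b,
    (measurePreserving_ballProb L).measureReal_preimage
      (measurableSet_separatingSet _ _).nullMeasurableSet]

theorem ae_ballProb_inner_ne_zero {a : E} (ha : a ≠ 0) : ∀ᵐ x ∂ballProb E, ⟪a, x⟫ ≠ 0 := by
  refine ProbabilityTheory.cond_absolutelyContinuous.ae_le (?_ : ∀ᵐ x, ⟪a, x⟫ ≠ 0)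
  have h := Measure.addHaar_submodule (volume : Measure E) (LinearMap.ker (innerₗ E a)) fun h => by
    have : a ∈ LinearMap.ker (innerₗ E a) := by rw [h]; trivial
    simp [ha] at this
  rw [ae_iff]
  convert h using 2
  ext x
  simp

theorem ballProb_real_separatingSet_self (a : E) : (ballProb E).real (separatingSet a a) = 0 := by
  simp [separatingSet]

theorem ballProb_real_separatingSet_neg {a : E} (ha : a ≠ 0) :
    (ballProb E).real (separatingSet a (-a)) = 1 := by
  rw [← probReal_univ (μ := ballProb E)]
  refine measureReal_congr ?_
  filter_upwards [ae_ballProb_inner_ne_zero ha] with x hx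
  refine eq_true ?_
  change ¬(0 ≤ ⟪a, x⟫ ↔ 0 ≤ ⟪-a, x⟫)
  rw [inner_neg_left]
  intro h
  rcases lt_or_gt_of_ne hx with h' | h'
  · linarith [h.mpr (by linarith)]
  · linarith [h.mp h'.le]

/-- If `b` is a nonnegative combination of `a` and `d`, then a hyperplane separating `a` from `d`
separates exactly one of the pairs `a, b` and `b, d`, and almost every other one separates
neither. -/
theorem ballProb_real_separatingSet_add {a b d : E} (ha : a ≠ 0) {p q r : ℝ} (hp : 0 < p)
    (hq : 0 ≤ q) (hr : 0 ≤ r) (h : p • a + q • d = r • b) :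
    (ballProb E).real (separatingSet a d) =
      (ballProb E).real (separatingSet a b) + (ballProb E).real (separatingSet b d) := by
  have hdisj : ∀ᵐ x ∂ballProb E, ¬(x ∈ separatingSet a b ∧ x ∈ separatingSet b d) := by
    filter_upwards [ae_ballProb_inner_ne_zero ha] with x hx
    rintro ⟨h1, h2⟩
    have hx' : p * ⟪a, x⟫ + q * ⟪d, x⟫ = r * ⟪b, x⟫ := by
      have := congrArg (fun y => ⟪y, x⟫) h
      simpa only [inner_add_left, real_inner_smul_left] using this
    simp only [separatingSet, Set.mem_ofPred_eq] at h1 h2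
    rcases lt_or_gt_of_ne hx with ha' | ha'
    · have hb : 0 ≤ ⟪b, x⟫ := by
        by_contra hb
        exact h1 ⟨fun h => absurd h ha'.not_ge, fun h => absurd h hb⟩
      have hd : ⟪d, x⟫ < 0 := by
        by_contra! hd
        exact h2 ⟨fun _ => hd, fun _ => hb⟩
      have h3 := mul_neg_of_pos_of_neg hp ha'
      have h4 := mul_nonpos_of_nonneg_of_nonpos hq hd.le
      have h5 := mul_nonneg hr hb
      linarith
    · have hb : ⟪b, x⟫ < 0 := by
        by_contra! hb
        exact h1 ⟨fun _ => hb, fun _ => ha'.le⟩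
      have hd : 0 ≤ ⟪d, x⟫ := by
        by_contra hd
        exact h2 ⟨fun h => absurd h hb.not_ge, fun h => absurd h hd⟩
      have h3 := mul_pos hp ha'
      have h4 := mul_nonneg hq hd
      have h5 := mul_nonpos_of_nonneg_of_nonpos hr hb.le
      linarith
  rw [← measureReal_union₀ (measurableSet_separatingSet b d).nullMeasurableSet]
  · refine measureReal_congr ?_
    filter_upwards [hdisj] with x hx
    refine propext ?_
    change x ∈ separatingSet a d ↔ x ∈ separatingSet a b ∨ x ∈ separatingSet b d
    simp only [separatingSet, Set.mem_ofPred_eq] at hx ⊢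
    tauto
  · rw [AEDisjoint, measure_eq_zero_iff_ae_notMem]
    exact hdisj

/-- The probability of separating two points of a circle is proportional to their angle: it is
additive in the angle, by reflection invariance. -/
theorem ballProb_real_separatingSet_circlePoint {u w : E} (hu : ‖u‖ = 1)
    (hw : ‖w‖ = 1) (huw : ⟪u, w⟫ = 0) {t : ℝ} (ht0 : 0 ≤ t) (ht : t ≤ π) :
    (ballProb E).real (separatingSet u (circlePoint u w t)) = t / π := by
  have hzero : circlePoint u w 0 = u := by simp [circlePoint]
  have hu0 : u ≠ 0 := by rintro rfl; simp at hu
  have h := eq_div_mul_of_add_of_nonneg (L := π)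
    (f := fun t => (ballProb E).real (separatingSet u (circlePoint u w t))) pi_pos
    (fun _ _ _ => measureReal_nonneg) ?_ ht0 ht
  · have hpi : circlePoint u w π = -u := by simp [circlePoint]
    simpa only [hpi, ballProb_real_separatingSet_neg hu0, mul_one] using h
  · intro s t hs ht hst
    rcases ht.eq_or_lt with rfl | ht
    · simp [hzero, ballProb_real_separatingSet_self]
    rcases hs.eq_or_lt with rfl | hs
    · simp [hzero, ballProb_real_separatingSet_self]
    have h1 : sin t • u + sin s • circlePoint u w (s + t) = sin (s + t) • circlePoint u w s := by
      simp only [circlePoint, cos_add, sin_add]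
      match_scalars
      · linear_combination (-sin t) * sin_sq_add_cos_sq s
      · ring
    have h2 : (ballProb E).real (separatingSet (circlePoint u w s) (circlePoint u w (s + t))) =
        (ballProb E).real (separatingSet u (circlePoint u w t)) := by
      rw [← ballProb_real_separatingSet_map
        (Submodule.span ℝ {circlePoint u w ((s + t) / 2)}).reflection,
        reflection_circlePoint hu hw huw, reflection_circlePoint hu hw huw, separatingSet_comm]
      ring_nf
      rw [hzero]
    rw [ballProb_real_separatingSet_add hu0 (sin_pos_of_pos_of_lt_pi ht (by linarith))
      (sin_nonneg_of_nonneg_of_le_pi hs.le (by linarith))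
      (sin_nonneg_of_nonneg_of_le_pi (by linarith) hst) h1, h2]

/-- A uniformly random hyperplane separates two unit vectors with probability `angle / π`. -/
theorem ballProb_real_separatingSet {u v : E} (hu : ‖u‖ = 1) (hv : ‖v‖ = 1) :
    (ballProb E).real (separatingSet u v) = angle u v / π := by
  have hu0 : u ≠ 0 := by rintro rfl; simp at hu
  have hcos : cos (angle u v) = ⟪u, v⟫ := by rw [cos_angle, hu, hv]; simp
  by_cases h1 : v = u
  · rw [h1, ballProb_real_separatingSet_self, angle_self hu0, zero_div]
  by_cases h2 : v = -u
  · rw [h2, ballProb_real_separatingSet_neg hu0, angle_self_neg_of_nonzero hu0,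
      div_self pi_ne_zero]
  have hsin : sin (angle u v) ≠ 0 := by
    intro h0
    have h := sin_sq_add_cos_sq (angle u v)
    rw [h0, hcos, zero_pow two_ne_zero, zero_add] at h
    rcases sq_eq_one_iff.mp h with h | h
    · exact h1 ((inner_eq_one_iff_of_norm_eq_one hu hv).mp h).symm
    · exact h2 (neg_eq_iff_eq_neg.mp ((inner_eq_neg_one_iff_of_norm_eq_one hu hv).mp h).symm)
  -- for `u`, `v` independent, `w` completes `u` to an orthonormal basis of their span
  set w := (sin (angle u v))⁻¹ • (v - cos (angle u v) • u) with hw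
  have hvw : circlePoint u w (angle u v) = v := by
    rw [circlePoint, hw, smul_inv_smul₀ hsin, add_sub_cancel]
  have huw : ⟪u, w⟫ = 0 := by
    rw [hw, real_inner_smul_right, inner_sub_right, real_inner_smul_right,
      real_inner_self_eq_norm_sq, hu, hcos]
    ring
  have hwn : ‖w‖ = 1 := by
    have h : ⟪v, v⟫ = 1 := by rw [real_inner_self_eq_norm_sq, hv, one_pow]
    rw [← hvw] at h
    have hwu : ⟪w, u⟫ = 0 := by rw [real_inner_comm, huw]
    simp only [circlePoint, inner_add_left, inner_add_right, real_inner_smul_left,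
      real_inner_smul_right, real_inner_self_eq_norm_sq, norm_smul, mul_pow, norm_eq_abs,
      sq_abs, hu, huw, hwu] at h
    have h' : sin (angle u v) ^ 2 * (‖w‖ ^ 2 - 1) = 0 := by
      linear_combination h - sin_sq_add_cos_sq (angle u v)
    have h'' := (mul_eq_zero.mp h').resolve_left (pow_ne_zero 2 hsin)
    exact (pow_eq_one_iff_of_nonneg (norm_nonneg _) two_ne_zero).mp (sub_eq_zero.mp h'')
  have h := ballProb_real_separatingSet_circlePoint hu hwn huw (angle_nonneg u v) (angle_le_pi u v)
  rwa [hvw] at h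

end RandomHyperplane

/-! ### The Goemans–Williamson constant -/

section AlphaGW

open Real

theorem one_sub_cos_pos {θ : ℝ} (h0 : 0 < θ) (hπ : θ ≤ π) : 0 < 1 - cos θ := by
  have := cos_lt_cos_of_nonneg_of_le_pi le_rfl hπ h0
  rw [cos_zero] at this
  linarith

/-- The bound `1 - cos θ ≤ θ ^ 2 / 2 ≤ π * θ / 2` gives `4 / π ^ 2 ≤ alphaGW`. -/
theorem alphaGW_pos : 0 < alphaGW := by
  refine lt_of_lt_of_le (b := 4 / π ^ 2) (by positivity) (le_csInf ?_ ?_)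
  · exact ⟨_, π, ⟨pi_pos, le_rfl⟩, rfl⟩
  · rintro _ ⟨θ, ⟨h0, hπ⟩, rfl⟩
    have h1 := one_sub_cos_pos h0 hπ
    have h2 := one_sub_sq_div_two_le_cos (x := θ)
    have h3 : 2 / π ≤ θ / (1 - cos θ) := by
      rw [div_le_div_iff₀ pi_pos h1]
      have : θ * θ ≤ θ * π := mul_le_mul_of_nonneg_left hπ h0.le
      nlinarith
    have h4 : 4 / π ^ 2 = 2 / π * (2 / π) := by ring
    rw [h4]
    exact mul_le_mul_of_nonneg_left h3 (by positivity)

theorem alphaGW_mul_one_sub_cos_le {θ : ℝ} (h0 : 0 ≤ θ) (hπ : θ ≤ π) :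
    alphaGW * ((1 - cos θ) / 2) ≤ θ / π := by
  rcases h0.eq_or_lt with rfl | h0
  · simp
  have h1 := one_sub_cos_pos h0 hπ
  have hbdd : BddBelow ((fun θ : ℝ => 2 / π * (θ / (1 - cos θ))) '' Set.Ioc 0 π) := by
    refine ⟨0, ?_⟩
    rintro _ ⟨t, ⟨ht0, htπ⟩, rfl⟩
    have := one_sub_cos_pos ht0 htπ
    positivity
  have h2 : alphaGW ≤ 2 / π * (θ / (1 - cos θ)) := csInf_le hbdd ⟨θ, ⟨h0, hπ⟩, rfl⟩
  calc alphaGW * ((1 - cos θ) / 2) ≤ 2 / π * (θ / (1 - cos θ)) * ((1 - cos θ) / 2) :=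
        mul_le_mul_of_nonneg_right h2 (by positivity)
    _ = θ / π := by field_simp

end AlphaGW

/-! ### Fractional cut covers -/

namespace SimpleGraph

open Matrix MeasureTheory
open scoped RealInnerProductSpace

variable {V : Type*} {G : SimpleGraph V}

theorem mk_mem_cutEdges_iff {S : Finset V} {i j : V} (hij : G.Adj i j) :
    s(i, j) ∈ G.cutEdges S ↔ ¬(i ∈ S ↔ j ∈ S) := by
  constructor
  · rintro ⟨-, u, hu, v, hv, h⟩
    rcases Sym2.eq_iff.mp h with ⟨rfl, rfl⟩ | ⟨rfl, rfl⟩ <;> tauto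
  · intro h
    refine ⟨hij, ?_⟩
    by_cases hi : i ∈ S
    · exact ⟨i, hi, j, by tauto, rfl⟩
    · exact ⟨j, by tauto, i, hi, Sym2.eq_swap⟩

variable [Fintype V]

/-- A fractional cut cover `y` yields the feasible matrix `∑ S, y S • x_S x_Sᵀ` of the same value,
where `x_S` is the vector equal to `1` on `S` and `-1` off `S`. -/
theorem fccValues_subset_etaDualValues : G.fccValues ⊆ G.etaDualValues := by
  classical
  rintro t ⟨y, hy0, hy, rfl⟩
  set x : Finset V → V → ℝ := fun S i => if i ∈ S then 1 else -1 with hx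
  have hN : ∀ i j, (∑ S, y S • vecMulVec (x S) (star (x S))) i j = ∑ S, y S * (x S i * x S j) := by
    intro i j
    simp [Matrix.sum_apply, vecMulVec_apply]
  have hsq : ∀ S i, x S i * x S i = 1 := by
    intro S i
    simp only [hx]
    split_ifs <;> norm_num
  refine ⟨Finset.sum_nonneg fun S _ => hy0 S, ∑ S, y S • vecMulVec (x S) (star (x S)), ?_, ?_, ?_⟩
  · exact Matrix.posSemidef_sum _ fun S _ => (posSemidef_vecMulVec_self_star (x S)).smul (hy0 S)
  · ext i
    rw [Matrix.diag_apply, hN]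
    simp [hsq]
  · intro i j hij
    refine (hy s(i, j) hij).trans_eq ?_
    simp only [lapAdjoint, hN, hsq]
    rw [Finset.mul_sum, ← Finset.sum_add_distrib, ← Finset.sum_sub_distrib, Finset.mul_sum]
    refine Finset.sum_congr rfl fun S _ => ?_
    by_cases h : s(i, j) ∈ G.cutEdges S
    · rw [Set.indicator_of_mem h]
      rw [mk_mem_cutEdges_iff hij] at h
      simp only [hx]
      split_ifs <;> first | (exfalso; tauto) | ring
    · rw [Set.indicator_of_notMem h]
      rw [mk_mem_cutEdges_iff hij] at h
      simp only [hx]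
      split_ifs <;> first | (exfalso; tauto) | ring

/-- The sign pattern of a random hyperplane: unit vectors attached to the vertices yield a
probability distribution `p` on cuts that cuts `ij` with probability `angle / π`. -/
theorem exists_cut_distribution {E : Type*} [NormedAddCommGroup E] [InnerProductSpace ℝ E]
    [FiniteDimensional ℝ E] (u : V → E) (hu : ∀ i, ‖u i‖ = 1) :
    ∃ p : Finset V → ℝ, (∀ S, 0 ≤ p S) ∧ ∑ S, p S = 1 ∧ ∀ i j, G.Adj i j →
      ∑ S, p S * (G.cutEdges S).indicator (fun _ => (1 : ℝ)) s(i, j) =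
        InnerProductGeometry.angle (u i) (u j) / Real.pi := by
  classical
  borelize E
  set f : E → Finset V := fun x => {i | 0 ≤ ⟪u i, x⟫} with hf
  have hmem : ∀ x i, i ∈ f x ↔ 0 ≤ ⟪u i, x⟫ := by simp [hf]
  have hmeas : ∀ S, MeasurableSet (f ⁻¹' {S}) := by
    intro S
    have hpre : f ⁻¹' {S} = ⋂ i, {x | 0 ≤ ⟪u i, x⟫ ↔ i ∈ S} := by
      ext x
      simp only [Set.mem_preimage, Set.mem_singleton_iff, Finset.ext_iff, hmem, Set.mem_iInter,
        Set.mem_ofPred_eq]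
    rw [hpre]
    refine MeasurableSet.iInter fun i => MeasurableSet.iff ?_ (MeasurableSet.const _)
    exact (isClosed_le continuous_const (by fun_prop)).measurableSet
  refine ⟨fun S => (ballProb E).real (f ⁻¹' {S}), fun _ => measureReal_nonneg, ?_, ?_⟩
  · rw [sum_measureReal_preimage_singleton _ fun S _ => hmeas S]
    simp
  · intro i j hij
    simp only [Set.indicator_apply, mul_ite, mul_one, mul_zero]
    rw [← Finset.sum_filter, sum_measureReal_preimage_singleton _ fun S _ => hmeas S,
      ← ballProb_real_separatingSet (hu i) (hu j)]
    congr 1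
    ext x
    simp [separatingSet, mk_mem_cutEdges_iff hij, hmem]

/-- Goemans–Williamson rounding: a Gram representation of `μ⁻¹ • N` by unit vectors turns a feasible
solution of the semidefinite program into a distribution on cuts; scaled by `μ / alphaGW`, it
covers every edge. -/
theorem div_alphaGW_mem_fccValues {μ : ℝ} (hμ0 : 0 < μ) (hμ : μ ∈ G.etaDualValues) :
    μ / alphaGW ∈ G.fccValues := by
  obtain ⟨-, N, hN, hdiag, hedge⟩ := hμ
  have hα := alphaGW_pos
  obtain ⟨m, v, hv⟩ := Matrix.posSemidef_iff_eq_sum_vecMulVec.mp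
    (hN.smul (inv_nonneg.mpr hμ0.le) : (μ⁻¹ • N).PosSemidef)
  set u : V → EuclideanSpace ℝ (Fin m) := fun i => WithLp.toLp 2 fun l => v l i with hu
  have hinner : ∀ i j, ⟪u i, u j⟫ = μ⁻¹ * N i j := by
    intro i j
    have := congrFun (congrFun hv i) j
    rw [Matrix.smul_apply, smul_eq_mul] at this
    rw [this, Matrix.sum_apply]
    simp [hu, PiLp.inner_apply, vecMulVec_apply, mul_comm]
  have hNd : ∀ i, N i i = μ := fun i => congrFun hdiag i
  have hunit : ∀ i, ‖u i‖ = 1 := by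
    intro i
    have := hinner i i
    rw [hNd, inv_mul_cancel₀ hμ0.ne', real_inner_self_eq_norm_sq] at this
    exact (pow_eq_one_iff_of_nonneg (norm_nonneg _) two_ne_zero).mp this
  obtain ⟨p, hp0, hp1, hp⟩ := exists_cut_distribution (G := G) u hunit
  refine ⟨fun S => μ / alphaGW * p S, fun S => mul_nonneg (by positivity) (hp0 S), ?_, ?_⟩
  · intro e
    induction e with | _ i j
    intro hij
    rw [mem_edgeSet] at hij
    simp only [mul_assoc, ← Finset.mul_sum]
    rw [hp i j hij]
    have h1 := alphaGW_mul_one_sub_cos_le (InnerProductGeometry.angle_nonneg (u i) (u j))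
      (InnerProductGeometry.angle_le_pi (u i) (u j))
    rw [InnerProductGeometry.cos_angle, hunit, hunit, mul_one, div_one, hinner] at h1
    have h2 := hedge i j hij
    rw [lapAdjoint, hNd, hNd] at h2
    calc (1 : ℝ) ≤ 1 / 4 * (μ + μ - 2 * N i j) := h2
      _ = μ / alphaGW * (alphaGW * ((1 - μ⁻¹ * N i j) / 2)) := by field_simp; ring
      _ ≤ _ := mul_le_mul_of_nonneg_left h1 (by positivity)
  · rw [← Finset.mul_sum, hp1, mul_one]

/-- The minimum defining the fractional cut-cover number is attained: the feasible `y` whose value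
is at most that of a fixed feasible solution form a compact set. -/
theorem isLeast_fcc (hne : G.fccValues.Nonempty) : IsLeast G.fccValues G.fcc := by
  obtain ⟨t, y₀, hy₀, hc₀, rfl⟩ := hne
  set K : Set (Finset V → ℝ) := {y | (∀ S, 0 ≤ y S) ∧
    (∀ e ∈ G.edgeSet, 1 ≤ ∑ S, y S * (G.cutEdges S).indicator (fun _ => (1 : ℝ)) e) ∧
    ∑ S, y S ≤ ∑ S, y₀ S} with hK
  have hclosed : IsClosed K := by
    simp only [hK, Set.ofPred_and, Set.ofPred_forall]
    refine IsClosed.inter (isClosed_iInter fun S => ?_) (IsClosed.inter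
      (isClosed_iInter fun e => isClosed_iInter fun _ => ?_) ?_) <;>
    exact isClosed_le (by fun_prop) (by fun_prop)
  have hcomp : IsCompact K := by
    refine (isCompact_Icc (a := (0 : Finset V → ℝ)) (b := fun _ => ∑ S, y₀ S)).of_isClosed_subset
      hclosed fun y hy => ⟨fun S => hy.1 S, fun S => ?_⟩
    exact (Finset.single_le_sum (fun T _ => hy.1 T) (Finset.mem_univ S)).trans hy.2.2
  obtain ⟨y, hy, hmin⟩ := hcomp.exists_isMinOn ⟨y₀, hy₀, hc₀, le_rfl⟩
    (f := fun y : Finset V → ℝ => ∑ S, y S) (by fun_prop)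
  have hleast : IsLeast G.fccValues (∑ S, y S) := by
    refine ⟨⟨y, hy.1, hy.2.1, rfl⟩, ?_⟩
    rintro _ ⟨z, hz0, hzc, rfl⟩
    rcases le_total (∑ S, z S) (∑ S, y₀ S) with h | h
    · exact hmin ⟨hz0, hzc, h⟩
    · exact hy.2.2.trans h
  rw [fcc, hleast.csInf_eq]
  exact hleast

end SimpleGraph

theorem mainTheorem4 {V : Type*} [Fintype V] [DecidableEq V]
    (G : SimpleGraph V) [DecidableRel G.Adj] (k : ℕ) (hk : G.IsRegularOfDegree k)
    (C : Finset (Matrix V V ℝ)) (hC : IsAssociationScheme C) (hA : G.adjMatrix ℝ ∈ C)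
    (lam : ℝ)
    (hlam : IsLeast {x : ℝ | Module.End.HasEigenvalue (Matrix.toLin' (G.adjMatrix ℝ)) x} lam) :
    (IsLeast G.etaDualValues G.etaDual ∧
      G.etaDual = 2 * (k : ℝ) / ((k : ℝ) - lam)) ∧
    (IsLeast G.fccValues G.fcc ∧
      1 ≤ G.fcc / (2 * (k : ℝ) / ((k : ℝ) - lam)) ∧
      G.fcc / (2 * (k : ℝ) / ((k : ℝ) - lam)) ≤ 1 / alphaGW) := by
  -- members of an association scheme are nonzero, so there is an edge and `k` is positive
  obtain ⟨i, j, hij⟩ : ∃ i j, G.Adj i j := by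
    by_contra! h
    refine hC.ne_zero _ hA ?_
    ext i j
    simp [h i j]
  have : Nonempty V := ⟨i⟩
  have hk0 : 0 < k := by
    rw [← hk i, G.degree_pos_iff_exists_adj]
    exact ⟨j, hij⟩
  have hk0' : (0 : ℝ) < k := by exact_mod_cast hk0
  have hpsd : (G.adjMatrix ℝ - lam • (1 : Matrix V V ℝ)).PosSemidef :=
    Matrix.IsHermitian.posSemidef_sub_smul_one
      (by rw [Matrix.IsHermitian, Matrix.conjTranspose_eq_transpose_of_trivial]
          exact G.isSymm_adjMatrix) fun x hx => hlam.2 hx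
  have hlam0 := SimpleGraph.nonpos_of_posSemidef_adjMatrix_sub hpsd
  have hkl : 0 < (k : ℝ) - lam := by linarith
  set η : ℝ := 2 * (k : ℝ) / ((k : ℝ) - lam) with hη
  have hη0 : 0 < η := by positivity
  have hleast : IsLeast G.etaDualValues η :=
    ⟨SimpleGraph.mem_etaDualValues_of_isAssociationScheme hk hk0 hlam0 hC hA hlam.1,
      fun μ hμ => hk.le_of_mem_etaDualValues hkl hpsd hμ⟩
  have heta : G.etaDual = η := hleast.csInf_eq
  have hround := SimpleGraph.div_alphaGW_mem_fccValues hη0 hleast.1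
  have hfcc := SimpleGraph.isLeast_fcc ⟨_, hround⟩
  refine ⟨⟨heta ▸ hleast, heta⟩, hfcc, ?_, ?_⟩
  · rw [one_le_div hη0]
    exact hleast.2 (SimpleGraph.fccValues_subset_etaDualValues hfcc.1)
  · rw [div_le_iff₀ hη0, one_div_mul_eq_div]
    exact hfcc.2 hround
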